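/- For $x\in\mathbb{R}$ let $F(x)=\dfrac{e^{-i\pi/4}}{\sqrt{\pi}}\displaystyle\int_x^{\infty}e^{it^2}\,dt$ (a convergent improper integral). For an integer $N\ge 0$ let $$A_N=\sqrt{(N+1/2)\pi},\qquad t_k=\frac{(k-1/2)\pi}{\sqrt{(N+1/2)\pi}}\quad(k=1,\dots,N),$$ $$F_N(x)=\frac12+\frac{i}{2}\tan\left(A_N x e^{i\pi/4}\right)+\frac{x}{A_N}\,e^{i(x^2+\pi/4)}\sum_{k=1}^N\frac{e^{-t_k^2}}{x^2+i t_k^2},$$ and $E_N(x)=F(x)-F_N(x)$. Let $\beta=1-\frac{\sqrt2}{2}-\frac{2\sqrt2+1}{16}$, and, with $h=\sqrt{\pi/(N+1/2)}=\pi/A_N$, define for $x\ge 0$ $$\Delta_h(x)=\begin{cases} \dfrac{x\,e^{-A_N^2}}{\sqrt{\pi}\,(A_N^2-x^2/2)\,(1-e^{-2A_N^2})}, & 0\le \dfrac{x}{\sqrt2}\le\frac34A_N,\\[2ex] \dfrac{4x\,e^{-A_N^2}\left(1+2\sqrt{\pi}\,e^{-\beta A_N^2}\right)}{\sqrt{\pi}\,A_N\,(A_N+x/\sqrt2)\,(1-e^{-2A_N^2})},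 & \frac34A_N<\dfrac{x}{\sqrt2}<\frac54A_N,\\[2ex] \dfrac{x\,e^{-A_N^2}}{\sqrt{\pi}\,(x^2/2-A_N^2)\,(1-e^{-2A_N^2})}+\dfrac{e^{-\sqrt2\,A_Nx}}{1-e^{-\sqrt2\,A_Nx}}, & \dfrac{x}{\sqrt2}\ge\frac54A_N. \end{cases}$$ Then, for every integer $N\ge 0$ and every $x\in\mathbb{R}$, $$|E_N(x)|\le\eta_N(x):=\Delta_h(|x|)+\frac{(2\pi+1)\,|x|}{2\pi A_N\sqrt{x^4+A_N^4}}\,e^{-A_N^2}.$$ -/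

import Mathlib

noncomputable section

namespace Fresnel

/-- The truncated Fresnel integral `e^{-iπ/4} / √π * ∫_x^R e^{i t²} dt`. -/
def truncF (x R : ℝ) : ℂ :=
  Complex.exp (-(Complex.I * Real.pi / 4)) / (Real.sqrt Real.pi : ℂ) *
    ∫ t in x..R, Complex.exp (Complex.I * (t : ℂ) ^ 2)

/-- The Fresnel integral `F(x) = e^{-iπ/4} / √π * ∫_x^∞ e^{i t²} dt`. The integral converges only
conditionally, so it is the improper integral, the limit of `truncF x R` as `R → ∞`. -/
def F (x : ℝ) : ℂ :=
  Filter.limUnder Filter.atTop (truncF x)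

/-- `A_N = √((N + 1/2) π)`. -/
def A (N : ℕ) : ℝ :=
  Real.sqrt (((N : ℝ) + 1 / 2) * Real.pi)

/-- The nodes `t_k = (k - 1/2) π / √((N + 1/2) π)`. -/
def node (N k : ℕ) : ℝ :=
  ((k : ℝ) - 1 / 2) * Real.pi / Real.sqrt (((N : ℝ) + 1 / 2) * Real.pi)

/-- The approximation
`F_N(x) = 1/2 + (i/2) tan(A_N x e^{iπ/4})
  + (x / A_N) e^{i(x² + π/4)} ∑_{k=1}^N e^{-t_k²} / (x² + i t_k²)`. -/
def approxF (N : ℕ) (x : ℝ) : ℂ :=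
  1 / 2 + Complex.I / 2 *
      Complex.tan ((A N : ℂ) * (x : ℂ) * Complex.exp (Complex.I * Real.pi / 4)) +
    (x : ℂ) / (A N : ℂ) * Complex.exp (Complex.I * ((x : ℂ) ^ 2 + Real.pi / 4)) *
      ∑ k ∈ Finset.Icc 1 N,
        Complex.exp (-(node N k : ℂ) ^ 2) / ((x : ℂ) ^ 2 + Complex.I * (node N k : ℂ) ^ 2)

/-- The error `E_N(x) = F(x) - F_N(x)`. -/
def err (N : ℕ) (x : ℝ) : ℂ :=
  F x - approxF N x

/-- `β = 1 - √2/2 - (2√2 + 1)/16`. -/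
def beta : ℝ :=
  1 - Real.sqrt 2 / 2 - (2 * Real.sqrt 2 + 1) / 16

/-- The function `Δ_h(x)`, `x ≥ 0`, for the step length `h = √(π / (N + 1/2)) = π / A_N`. -/
def Delta (N : ℕ) (x : ℝ) : ℝ :=
  if x / Real.sqrt 2 ≤ 3 / 4 * A N then
    x * Real.exp (-(A N) ^ 2) /
      (Real.sqrt Real.pi * ((A N) ^ 2 - x ^ 2 / 2) * (1 - Real.exp (-2 * (A N) ^ 2)))
  else if x / Real.sqrt 2 < 5 / 4 * A N then
    4 * x * Real.exp (-(A N) ^ 2) *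
        (1 + 2 * Real.sqrt Real.pi * Real.exp (-beta * (A N) ^ 2)) /
      (Real.sqrt Real.pi * A N * (A N + x / Real.sqrt 2) * (1 - Real.exp (-2 * (A N) ^ 2)))
  else
    x * Real.exp (-(A N) ^ 2) /
        (Real.sqrt Real.pi * (x ^ 2 / 2 - (A N) ^ 2) * (1 - Real.exp (-2 * (A N) ^ 2))) +
      Real.exp (-Real.sqrt 2 * A N * x) / (1 - Real.exp (-Real.sqrt 2 * A N * x))

/-- The error bound `η_N(x) = Δ_h(|x|) + (2π + 1)|x| / (2π A_N √(x⁴ + A_N⁴)) * e^{-A_N²}`. -/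
def eta (N : ℕ) (x : ℝ) : ℝ :=
  Delta N |x| +
    (2 * Real.pi + 1) * |x| / (2 * Real.pi * A N * Real.sqrt (x ^ 4 + (A N) ^ 4)) *
      Real.exp (-(A N) ^ 2)

end Fresnel

end

open MeasureTheory Set Filter Topology

noncomputable section

namespace Fresnel

/-! Write `G` for `gaussLaplace`, `p = rotate x = e^{-iπ/4} x`, `a = A N`, `τ_n = halfNode a n`.
Since `(e^{-q²} G(q))' = -2 e^{-q²}`, the Fresnel integral is `F(x) = e^{ix²} G(p) / (2√π)`. The
Laplace transform at `p` of the half-shifted theta identity equates, up to the factor `a/√π`, `∑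
e^{-τ_n²} / (p - iτ_n)` with `∑ (-1)^n e^{-n²a²} G(p - na)` (`exists_hasSum_halfNode`). The left
side is the untruncated trapezium sum and the term `n = 0` on the right is `G(p)`.

The terms `±m` are rearranged by the reflection `G(q) + G(-q) = 2√π e^{q²}`: the Gaussians that
split off form a geometric series, which is exactly the tangent term, and `G(ma + p) - G(ma - p)`
remains. Hence the error is an aliasing series plus the tail of the node sum
(`exists_discretisation_error`).

The aliasing series gives `Delta`, with three bounds on the differences according to the position of
`X = x/√2` relative to `a` (`norm_alias_sum_div_le_Delta`). The tail is dominated by a geometric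
series of ratio `e^{-2π}` (`norm_node_tail_le`). Oddness of the error reduces everything to `x > 0`.
-/

/-! ### The Gaussian Laplace transform: differential equation, reflection, bounds. -/

/-- The Laplace transform `∫_0^∞ e^{-q s - s²/4} ds` of a Gaussian, which is `√π e^{q²} erfc q`. -/
def gaussLaplace (q : ℂ) : ℂ :=
  ∫ s in Ioi (0 : ℝ), Complex.exp (-(q * s) - (s : ℂ) ^ 2 / 4)

lemma norm_exp_sub_sq (q : ℂ) (s : ℝ) :
    ‖Complex.exp (-(q * s) - (s : ℂ) ^ 2 / 4)‖ = Real.exp (-(q.re * s) - s ^ 2 / 4) := by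
  rw [Complex.norm_exp]
  congr 1
  have : (s : ℂ) ^ 2 / 4 = ((s ^ 2 / 4 : ℝ) : ℂ) := by push_cast; ring
  rw [this, Complex.sub_re, Complex.neg_re, Complex.re_mul_ofReal, Complex.ofReal_re]

lemma integrable_exp_sub_sq (q : ℂ) :
    Integrable (fun s : ℝ => Complex.exp (-(q * s) - (s : ℂ) ^ 2 / 4)) := by
  have h := integrable_cexp_quadratic (b := 1 / 4) (by norm_num) (-q) 0
  refine h.congr (Eventually.of_forall fun s => ?_)
  simp only
  congr 1
  ring

lemma integrable_real_exp_sub_sq (a : ℝ) :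
    Integrable (fun s : ℝ => Real.exp (-(a * s) - s ^ 2 / 4)) := by
  have h := (integrable_exp_sub_sq a).norm
  refine h.congr (Eventually.of_forall fun s => ?_)
  simp only
  rw [norm_exp_sub_sq]
  simp

/-- Domination needed to differentiate under the integral; the factor `s` is absorbed by `s ≤ e^s`.
-/
lemma mul_exp_le (b s : ℝ) (hs : 0 < s) {q : ℂ} (hq : -b ≤ q.re) :
    ‖-(s : ℂ) * Complex.exp (-(q * s) - (s : ℂ) ^ 2 / 4)‖ ≤
      Real.exp (-(-(b + 1) * s) - s ^ 2 / 4) := by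
  rw [norm_mul, norm_exp_sub_sq, norm_neg, Complex.norm_real, Real.norm_of_nonneg hs.le]
  calc s * Real.exp (-(q.re * s) - s ^ 2 / 4)
      ≤ Real.exp s * Real.exp (b * s - s ^ 2 / 4) := by
        gcongr
        · linarith [Real.add_one_le_exp s]
        · nlinarith
    _ = _ := by rw [← Real.exp_add]; congr 1; ring

lemma hasDerivAt_gaussLaplace_aux (q : ℂ) :
    IntegrableOn (fun s : ℝ => -(s : ℂ) * Complex.exp (-(q * s) - (s : ℂ) ^ 2 / 4)) (Ioi 0) ∧
    HasDerivAt gaussLaplace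
      (∫ s in Ioi (0 : ℝ), -(s : ℂ) * Complex.exp (-(q * s) - (s : ℂ) ^ 2 / 4)) q := by
  refine hasDerivAt_integral_of_dominated_loc_of_deriv_le
    (F := fun (q : ℂ) (s : ℝ) => Complex.exp (-(q * s) - (s : ℂ) ^ 2 / 4))
    (F' := fun (q : ℂ) (s : ℝ) => -(s : ℂ) * Complex.exp (-(q * s) - (s : ℂ) ^ 2 / 4))
    (μ := volume.restrict (Ioi (0 : ℝ)))
    (bound := fun s => Real.exp (-(-(‖q‖ + 1 + 1) * s) - s ^ 2 / 4))
    (Metric.ball_mem_nhds q one_pos) ?_ (integrable_exp_sub_sq q).integrableOn ?_ ?_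
    (integrable_real_exp_sub_sq _).integrableOn ?_
  · exact Eventually.of_forall fun z => by fun_prop
  · fun_prop
  · refine (ae_restrict_mem measurableSet_Ioi).mono fun s hs z hz => ?_
    refine mul_exp_le _ _ hs ?_
    have h1 : ‖z‖ ≤ ‖q‖ + 1 := by
      have := norm_le_norm_add_norm_sub' z q
      rw [Metric.mem_ball, dist_eq_norm] at hz
      linarith
    linarith [neg_le_of_abs_le (Complex.abs_re_le_norm z)]
  · refine Eventually.of_forall fun s z _ => ?_
    have h : HasDerivAt (fun q : ℂ => -(q * s) - (s : ℂ) ^ 2 / 4) (-(s : ℂ)) z := by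
      simpa using (((hasDerivAt_id z).mul_const (s : ℂ)).neg).sub_const ((s : ℂ) ^ 2 / 4)
    simpa [mul_comm] using h.cexp

/-- With `f` the integrand, `f' = -q f - (s/2) f` integrates over the half-line to `-f(0) = -1`,
while `-s f` integrates to the derivative of the transform. -/
lemma hasDerivAt_gaussLaplace (q : ℂ) :
    HasDerivAt gaussLaplace (2 * q * gaussLaplace q - 2) q := by
  obtain ⟨hint, hder⟩ := hasDerivAt_gaussLaplace_aux q
  convert hder using 1
  set f : ℝ → ℂ := fun s => Complex.exp (-(q * s) - (s : ℂ) ^ 2 / 4) with hf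
  have hfi : IntegrableOn f (Ioi 0) := (integrable_exp_sub_sq q).integrableOn
  have hd : ∀ s : ℝ, HasDerivAt f (-q * f s + (1 / 2) * (-(s : ℂ) * f s)) s := by
    intro s
    have h1 : HasDerivAt (fun s : ℝ => (s : ℂ)) 1 s := Complex.ofRealCLM.hasDerivAt
    have h2 : HasDerivAt (fun s : ℝ => -(q * s) - (s : ℂ) ^ 2 / 4) (-q - s / 2) s :=
      ((h1.const_mul q).neg.sub ((h1.pow 2).div_const 4)).congr_deriv (by push_cast; ring)
    exact h2.cexp.congr_deriv (by ring)
  have hi' : IntegrableOn (fun s : ℝ => -q * f s + (1 / 2) * (-(s : ℂ) * f s)) (Ioi 0) :=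
    (hfi.const_mul _).add (hint.const_mul _)
  have ht : Tendsto f atTop (𝓝 0) :=
    tendsto_zero_of_hasDerivAt_of_integrableOn_Ioi (fun s _ => hd s) hi' hfi
  have key := integral_Ioi_of_hasDerivAt_of_tendsto' (a := 0) (fun s _ => hd s) hi' ht
  rw [integral_add (hfi.const_mul _) (hint.const_mul _), integral_const_mul,
    integral_const_mul] at key
  have h0 : f 0 = 1 := by simp [hf]
  have hg : gaussLaplace q = ∫ s in Ioi (0 : ℝ), f s := rfl
  rw [h0, ← hg] at key
  linear_combination -2 * key

lemma hasDerivAt_exp_mul_gaussLaplace (q : ℂ) :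
    HasDerivAt (fun q => Complex.exp (-q ^ 2) * gaussLaplace q) (-2 * Complex.exp (-q ^ 2)) q := by
  have h : HasDerivAt (fun q : ℂ => -q ^ 2) (-(2 * q)) q :=
    ((hasDerivAt_pow 2 q).neg).congr_deriv (by push_cast; ring)
  exact (h.cexp.mul (hasDerivAt_gaussLaplace q)).congr_deriv (by ring)

lemma norm_gaussLaplace_le {q : ℂ} (hq : 0 < q.re) : ‖gaussLaplace q‖ ≤ 1 / q.re := by
  have hi : IntegrableOn (fun s : ℝ => Real.exp (-q.re * s)) (Ioi 0) :=
    integrableOn_exp_mul_Ioi (by linarith) 0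
  calc ‖gaussLaplace q‖ ≤ ∫ s in Ioi (0 : ℝ), Real.exp (-q.re * s) := by
        refine norm_integral_le_of_norm_le hi (Eventually.of_forall fun s => ?_)
        rw [norm_exp_sub_sq]
        gcongr
        nlinarith [sq_nonneg s]
    _ = 1 / q.re := by
        rw [integral_exp_mul_Ioi (by linarith)]
        simp

/-- After `s ↦ -s` the two half-line integrals join into one Gaussian integral over the whole line.
-/
lemma gaussLaplace_add_neg (q : ℂ) :
    gaussLaplace q + gaussLaplace (-q) = 2 * Real.sqrt Real.pi * Complex.exp (q ^ 2) := by
  set f : ℝ → ℂ := fun s => Complex.exp (-(q * s) - (s : ℂ) ^ 2 / 4) with hf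
  have hn : gaussLaplace (-q) = ∫ s in Iic (0 : ℝ), f s := by
    have := integral_comp_neg_Ioi (0 : ℝ) f
    rw [neg_zero] at this
    rw [← this, gaussLaplace]
    congr 1
    ext s
    simp [hf]
  have hsum : gaussLaplace q + gaussLaplace (-q) = ∫ s : ℝ, f s := by
    rw [hn, add_comm]
    exact intervalIntegral.integral_Iic_add_Ioi (integrable_exp_sub_sq q).integrableOn
      (integrable_exp_sub_sq q).integrableOn
  have hI : ∫ s : ℝ, f s = ∫ s : ℝ, Complex.exp ((-1 / 4 : ℂ) * (s : ℂ) ^ 2 + (-q) * s + 0) := by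
    congr 1
    ext s
    simp only [hf]
    congr 1
    ring
  rw [hsum, hI, integral_cexp_quadratic (by norm_num)]
  have h1 : ((Real.pi : ℂ) / -(-1 / 4)) = ((4 * Real.pi : ℝ) : ℂ) := by push_cast; ring
  have h2 : (1 / 2 : ℂ) = ((1 / 2 : ℝ) : ℂ) := by push_cast; ring
  rw [h1, h2, ← Complex.ofReal_cpow (by positivity), ← Real.sqrt_eq_rpow,
    Real.sqrt_mul (by norm_num), show (4 : ℝ) = 2 ^ 2 by norm_num, Real.sqrt_sq (by norm_num)]
  push_cast
  congr 2
  ring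

/-- With `u = Xs`, the squared left side is `4(sinh² u + sin² u)`, and `|sin u| ≤ sinh u`. -/
lemma norm_exp_sub_exp_neg_le {X s : ℝ} (hX : 0 ≤ X) (hs : 0 ≤ s) :
    ‖Complex.exp (-((1 - Complex.I) * X * s)) - Complex.exp ((1 - Complex.I) * X * s)‖ ≤
      Real.sqrt 2 * (Real.exp (X * s) - Real.exp (-(X * s))) := by
  set u := X * s with hu
  have hu0 : 0 ≤ u := mul_nonneg hX hs
  have e : (1 - Complex.I) * X * s = (u : ℂ) + (-u : ℝ) * Complex.I := by
    simp only [hu]; push_cast; ring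
  have hsin : Real.sin u ^ 2 ≤ Real.sinh u ^ 2 := by
    rw [sq_le_sq]
    calc |Real.sin u| ≤ |u| := Real.abs_sin_le_abs
      _ = u := abs_of_nonneg hu0
      _ ≤ Real.sinh u := Real.self_le_sinh_iff.2 hu0
      _ ≤ _ := le_abs_self _
  have hsh : 0 ≤ Real.exp u - Real.exp (-u) := by
    have : Real.exp (-u) ≤ Real.exp u := Real.exp_le_exp.2 (by linarith)
    linarith
  rw [← abs_of_nonneg (norm_nonneg _),
    ← abs_of_nonneg (a := Real.sqrt 2 * _) (mul_nonneg (Real.sqrt_nonneg _) hsh)]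
  rw [← sq_le_sq, mul_pow, Real.sq_sqrt (by norm_num), ← Complex.normSq_eq_norm_sq,
    Complex.normSq_apply, e, neg_add, ← neg_mul, ← Complex.ofReal_neg, ← Complex.ofReal_neg,
    neg_neg]
  simp only [Complex.sub_re, Complex.sub_im, Complex.exp_add_mul_I]
  rw [Real.sinh_eq] at hsin
  simp only [← Complex.ofReal_exp, ← Complex.ofReal_cos, ← Complex.ofReal_sin, Complex.mul_re,
    Complex.mul_im, Complex.add_re, Complex.add_im, Complex.ofReal_re, Complex.ofReal_im,
    Complex.I_re, Complex.I_im, Real.cos_neg, Real.sin_neg]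
  have hE : Real.exp u * Real.exp (-u) = 1 := by rw [← Real.exp_add]; simp
  nlinarith [Real.sin_sq_add_cos_sq u]

lemma norm_gaussLaplace_add_sub_le {a X : ℝ} (hX : 0 ≤ X) (haX : X < a) :
    ‖gaussLaplace (a + (1 - Complex.I) * X) - gaussLaplace (a - (1 - Complex.I) * X)‖ ≤
      2 * Real.sqrt 2 * X / (a ^ 2 - X ^ 2) := by
  have hi1 : IntegrableOn (fun s : ℝ => Real.exp ((X - a) * s)) (Ioi 0) :=
    integrableOn_exp_mul_Ioi (by linarith) 0
  have hi2 : IntegrableOn (fun s : ℝ => Real.exp (-(X + a) * s)) (Ioi 0) :=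
    integrableOn_exp_mul_Ioi (by linarith) 0
  rw [gaussLaplace, gaussLaplace, ← integral_sub (integrable_exp_sub_sq _).integrableOn
    (integrable_exp_sub_sq _).integrableOn]
  calc _ ≤ ∫ s in Ioi (0 : ℝ),
        Real.sqrt 2 * (Real.exp ((X - a) * s) - Real.exp (-(X + a) * s)) := by
        refine norm_integral_le_of_norm_le ((hi1.sub hi2).const_mul _)
          ((ae_restrict_mem measurableSet_Ioi).mono fun s (hs : 0 < s) => ?_)
        have h := norm_exp_sub_exp_neg_le hX hs.le
        have e1 : Complex.exp (-((a + (1 - Complex.I) * X) * s) - (s : ℂ) ^ 2 / 4) -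
            Complex.exp (-((a - (1 - Complex.I) * X) * s) - (s : ℂ) ^ 2 / 4) =
            Complex.exp (-((a : ℂ) * s) - (s : ℂ) ^ 2 / 4) *
              (Complex.exp (-((1 - Complex.I) * X * s)) -
                Complex.exp ((1 - Complex.I) * X * s)) := by
          rw [mul_sub, ← Complex.exp_add, ← Complex.exp_add]
          congr 2 <;> ring
        rw [e1, norm_mul, norm_exp_sub_sq, Complex.ofReal_re]
        calc _ ≤ Real.exp (-(a * s)) *
              (Real.sqrt 2 * (Real.exp (X * s) - Real.exp (-(X * s)))) := by
              gcongr
              nlinarith [sq_nonneg s]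
          _ = _ := by
            rw [mul_left_comm, mul_sub, ← Real.exp_add, ← Real.exp_add]
            ring_nf
    _ = _ := by
        rw [integral_const_mul, integral_sub hi1 hi2, integral_exp_mul_Ioi (by linarith),
          integral_exp_mul_Ioi (by linarith)]
        have h1 : a - X ≠ 0 := by linarith
        have h2 : a + X ≠ 0 := by linarith
        have h3 : X - a ≠ 0 := by linarith
        have h4 : X + a ≠ 0 := by linarith
        have h5 : a ^ 2 - X ^ 2 ≠ 0 := by
          rw [sq_sub_sq]; exact mul_ne_zero h2 h1
        simp only [mul_zero, Real.exp_zero]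
        field_simp
        ring

lemma norm_exp_neg_sq_sub (a X : ℝ) :
    ‖Complex.exp (-((a : ℂ) - (1 - Complex.I) * X) ^ 2)‖ = Real.exp (-a ^ 2 + 2 * a * X) := by
  have h : -((a : ℂ) - (1 - Complex.I) * X) ^ 2 =
      ((-a ^ 2 + 2 * a * X : ℝ) : ℂ) + ((2 * X ^ 2 - 2 * a * X : ℝ) : ℂ) * Complex.I := by
    push_cast
    linear_combination (-(X : ℂ) ^ 2) * Complex.I_sq
  rw [h, Complex.norm_exp, Complex.add_re, Complex.re_ofReal_mul, Complex.ofReal_re]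
  simp

/-- Uniform in `X`, hence usable where `X` is close to `a`. Along `q(y) = a - (1-i)y` the derivative
of `e^{-q²} G(q)` has norm `2√2 e^{-a²+2ay}`, which is the derivative of `(√2/a) e^{-a²+2ay}`.
Comparison from `y = 0` gives the bound, as `|e^{-q²}| = e^{-a²+2ay}` cancels. -/
lemma norm_gaussLaplace_sub_le {a X : ℝ} (ha : 0 < a) (hX : 0 ≤ X) :
    ‖gaussLaplace (a - (1 - Complex.I) * X)‖ ≤ Real.sqrt 2 / a := by
  have hs2 : ‖(1 - Complex.I : ℂ)‖ = Real.sqrt 2 := by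
    rw [Complex.norm_def, Complex.normSq_apply]
    norm_num
  set q : ℝ → ℂ := fun y => a - (1 - Complex.I) * y with hq
  have hqd : ∀ y, HasDerivAt q (-(1 - Complex.I)) y := by
    intro y
    have h1 : HasDerivAt (fun s : ℝ => (s : ℂ)) 1 y := Complex.ofRealCLM.hasDerivAt
    simpa using (h1.const_mul (1 - Complex.I)).const_sub (a : ℂ)
  have hgd : ∀ y, HasDerivAt (fun y => Complex.exp (-(q y) ^ 2) * gaussLaplace (q y))
      ((-2 * Complex.exp (-(q y) ^ 2)) * (-(1 - Complex.I))) y := fun y =>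
    (hasDerivAt_exp_mul_gaussLaplace (q y)).comp y (hqd y)
  have hB : ∀ y : ℝ, HasDerivAt (fun y => Real.sqrt 2 / a * Real.exp (-a ^ 2 + 2 * a * y))
      (2 * Real.sqrt 2 * Real.exp (-a ^ 2 + 2 * a * y)) y := by
    intro y
    have h : HasDerivAt (fun y => -a ^ 2 + 2 * a * y) (2 * a) y := by
      simpa using ((hasDerivAt_id y).const_mul (2 * a)).const_add (-a ^ 2)
    exact (h.exp.const_mul (Real.sqrt 2 / a)).congr_deriv (by field_simp)
  have key := image_norm_le_of_norm_deriv_right_le_deriv_boundary (a := 0) (b := X)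
    (f := fun y => Complex.exp (-(q y) ^ 2) * gaussLaplace (q y))
    (fun y _ => (hgd y).continuousAt.continuousWithinAt)
    (fun y _ => (hgd y).hasDerivWithinAt) (B := fun y => Real.sqrt 2 / a *
      Real.exp (-a ^ 2 + 2 * a * y)) ?_ hB ?_ (right_mem_Icc.2 hX)
  · simp only [hq, norm_mul, norm_exp_neg_sq_sub] at key
    rw [mul_comm] at key
    exact le_of_mul_le_mul_right key (Real.exp_pos _)
  · simp only [hq, norm_mul, norm_exp_neg_sq_sub]
    rw [mul_comm]
    gcongr
    have h := norm_gaussLaplace_le (q := (a : ℂ)) (by simpa using ha)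
    simp only [Complex.ofReal_re] at h
    simp only [Complex.ofReal_zero, mul_zero, sub_zero]
    refine h.trans ?_
    gcongr
    rw [Real.one_le_sqrt]
    norm_num
  · intro y _
    rw [norm_mul, norm_mul, norm_neg (1 - Complex.I), hs2]
    simp only [hq, norm_exp_neg_sq_sub]
    norm_num
    linarith

/-! ### Rotation by `e^{-iπ/4}` and the closed form of the Fresnel integral. -/

lemma exp_I_pi_div_four :
    Complex.exp (Complex.I * Real.pi / 4) = (1 + Complex.I) / (Real.sqrt 2 : ℝ) := by
  have e : Complex.I * Real.pi / 4 = ((Real.pi / 4 : ℝ) : ℂ) * Complex.I := by push_cast; ring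
  have h2 : ((Real.sqrt 2 : ℝ) : ℂ) ^ 2 = 2 := by
    rw [← Complex.ofReal_pow, Real.sq_sqrt (by norm_num)]; norm_num
  have h0 : ((Real.sqrt 2 : ℝ) : ℂ) ≠ 0 := by
    intro h; rw [h] at h2; norm_num at h2
  rw [e, Complex.exp_mul_I, ← Complex.ofReal_cos, ← Complex.ofReal_sin, Real.cos_pi_div_four,
    Real.sin_pi_div_four]
  push_cast
  field_simp
  linear_combination (1 + Complex.I) * h2

lemma exp_neg_I_pi_div_four :
    Complex.exp (-(Complex.I * Real.pi / 4)) = (1 - Complex.I) / (Real.sqrt 2 : ℝ) := by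
  have h2 : ((Real.sqrt 2 : ℝ) : ℂ) ^ 2 = 2 := by
    rw [← Complex.ofReal_pow, Real.sq_sqrt (by norm_num)]; norm_num
  have h0 : ((Real.sqrt 2 : ℝ) : ℂ) ≠ 0 := by
    intro h; rw [h] at h2; norm_num at h2
  rw [Complex.exp_neg, exp_I_pi_div_four]
  refine inv_eq_of_mul_eq_one_right ?_
  field_simp
  linear_combination -Complex.I_sq - h2

/-- The point `e^{-iπ/4} x`. -/
def rotate (x : ℝ) : ℂ :=
  (1 - Complex.I) * ((x / Real.sqrt 2 : ℝ) : ℂ)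

lemma rotate_eq (x : ℝ) : rotate x = Complex.exp (-(Complex.I * Real.pi / 4)) * x := by
  rw [exp_neg_I_pi_div_four, rotate]
  push_cast
  ring

lemma rotate_re (x : ℝ) : (rotate x).re = x / Real.sqrt 2 := by
  simp [rotate, -Complex.ofReal_div]

lemma rotate_sq (x : ℝ) : rotate x ^ 2 = -(Complex.I * (x : ℂ) ^ 2) := by
  have h2 : ((x / Real.sqrt 2 : ℝ) : ℂ) ^ 2 = (x : ℂ) ^ 2 / 2 := by
    rw [← Complex.ofReal_pow, div_pow, Real.sq_sqrt (by norm_num)]; push_cast; ring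
  rw [rotate, mul_pow, h2]
  linear_combination (x : ℂ) ^ 2 / 2 * Complex.I_sq

lemma norm_exp_I_mul_sq (x : ℝ) : ‖Complex.exp (Complex.I * (x : ℂ) ^ 2)‖ = 1 := by
  rw [← Complex.ofReal_pow, mul_comm, Complex.norm_exp_ofReal_mul_I]

/-- A closed form of the Fresnel integral in terms of `gaussLaplace`. -/
def closedF (x : ℝ) : ℂ :=
  Complex.exp (-rotate x ^ 2) * gaussLaplace (rotate x) / (2 * Real.sqrt Real.pi)

lemma hasDerivAt_closedF (x : ℝ) :
    HasDerivAt closedF (-(Complex.exp (-(Complex.I * Real.pi / 4)) / (Real.sqrt Real.pi : ℂ) *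
      Complex.exp (Complex.I * (x : ℂ) ^ 2))) x := by
  have h1 : HasDerivAt (fun s : ℝ => (s : ℂ)) 1 x := Complex.ofRealCLM.hasDerivAt
  have hr : HasDerivAt rotate (Complex.exp (-(Complex.I * Real.pi / 4))) x := by
    rw [funext rotate_eq]
    simpa using h1.const_mul (Complex.exp (-(Complex.I * Real.pi / 4)))
  have h := ((hasDerivAt_exp_mul_gaussLaplace (rotate x)).comp x hr).div_const
    (2 * (Real.sqrt Real.pi : ℂ))
  refine h.congr_deriv ?_
  rw [rotate_sq, neg_neg]
  have : (Real.sqrt Real.pi : ℂ) ≠ 0 := by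
    rw [Complex.ofReal_ne_zero]; exact (Real.sqrt_pos.2 Real.pi_pos).ne'
  field_simp

lemma truncF_eq (x R : ℝ) : truncF x R = closedF x - closedF R := by
  have hc : Continuous fun t : ℝ => Complex.exp (-(Complex.I * Real.pi / 4)) /
      (Real.sqrt Real.pi : ℂ) * Complex.exp (Complex.I * (t : ℂ) ^ 2) := by fun_prop
  have h := intervalIntegral.integral_eq_sub_of_hasDerivAt
    (fun t (_ : t ∈ uIcc x R) => hasDerivAt_closedF t) (hc.neg.intervalIntegrable x R)
  rw [intervalIntegral.integral_neg, intervalIntegral.integral_const_mul] at h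
  rw [truncF]
  linear_combination -h

lemma tendsto_closedF : Tendsto closedF atTop (𝓝 0) := by
  have hlim : Tendsto (fun R : ℝ => Real.sqrt 2 / (2 * Real.sqrt Real.pi) / R) atTop (𝓝 0) :=
    tendsto_const_nhds.div_atTop tendsto_id
  refine squeeze_zero_norm' ?_ hlim
  filter_upwards [eventually_gt_atTop 0] with R hR
  have hre : 0 < (rotate R).re := by rw [rotate_re]; positivity
  have h := norm_gaussLaplace_le hre
  rw [rotate_re] at h
  have hpi : 0 < Real.sqrt Real.pi := Real.sqrt_pos.2 Real.pi_pos
  rw [closedF, norm_div, norm_mul, rotate_sq, neg_neg, norm_exp_I_mul_sq, one_mul, norm_mul,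
    Complex.norm_real, Real.norm_of_nonneg hpi.le, Complex.norm_ofNat]
  calc _ ≤ 1 / (R / Real.sqrt 2) / (2 * Real.sqrt Real.pi) := by gcongr
    _ = _ := by field_simp

lemma tendsto_truncF (x : ℝ) : Tendsto (truncF x) atTop (𝓝 (closedF x)) := by
  rw [funext (truncF_eq x)]
  simpa using tendsto_closedF.const_sub (closedF x)

lemma F_eq_closedF (x : ℝ) : F x = closedF x :=
  (tendsto_truncF x).limUnder_eq

/-! ### Oddness of the error. -/

lemma F_add_F_neg (x : ℝ) : F x + F (-x) = 1 := by
  have hr : rotate (-x) = -rotate x := by simp [rotate]; ring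
  have : (Real.sqrt Real.pi : ℂ) ≠ 0 := by
    rw [Complex.ofReal_ne_zero]; exact (Real.sqrt_pos.2 Real.pi_pos).ne'
  rw [F_eq_closedF, F_eq_closedF, closedF, closedF, hr, neg_sq, ← add_div, ← mul_add,
    gaussLaplace_add_neg, mul_left_comm, ← Complex.exp_add]
  simp
  exact_mod_cast this

lemma approxF_add_approxF_neg (N : ℕ) (x : ℝ) : approxF N x + approxF N (-x) = 1 := by
  simp only [approxF, Complex.ofReal_neg, mul_neg, neg_mul, Complex.tan_neg, neg_sq]
  ring

lemma err_neg (N : ℕ) (x : ℝ) : err N (-x) = -err N x := by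
  rw [err, err]
  linear_combination F_add_F_neg x - approxF_add_approxF_neg N x

lemma err_zero (N : ℕ) : err N 0 = 0 := by
  have h := err_neg N 0
  rw [neg_zero] at h
  linear_combination h / 2

/-! ### Real estimates and the theta transformation. -/

lemma gaussLaplace_ofReal (b : ℝ) :
    gaussLaplace b = ((∫ s in Ioi (0 : ℝ), Real.exp (-(b * s) - s ^ 2 / 4) : ℝ) : ℂ) := by
  rw [gaussLaplace, ← integral_complex_ofReal]
  congr 1
  ext s
  push_cast
  rfl

lemma integral_real_exp_nonneg (b : ℝ) :
    0 ≤ ∫ s in Ioi (0 : ℝ), Real.exp (-(b * s) - s ^ 2 / 4) :=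
  integral_nonneg fun _ => (Real.exp_pos _).le

lemma integral_real_exp_le_inv {b : ℝ} (hb : 0 < b) :
    ∫ s in Ioi (0 : ℝ), Real.exp (-(b * s) - s ^ 2 / 4) ≤ 1 / b := by
  have h := norm_gaussLaplace_le (q := (b : ℂ)) (by simpa using hb)
  rwa [gaussLaplace_ofReal, Complex.norm_real, Real.norm_of_nonneg (integral_real_exp_nonneg b)]
    at h

lemma integral_real_exp_le_exp_sq (b : ℝ) :
    ∫ s in Ioi (0 : ℝ), Real.exp (-(b * s) - s ^ 2 / 4) ≤
      2 * Real.sqrt Real.pi * Real.exp (b ^ 2) := by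
  have h := gaussLaplace_add_neg (b : ℂ)
  rw [← Complex.ofReal_neg, gaussLaplace_ofReal, gaussLaplace_ofReal] at h
  have h' := congrArg Complex.re h
  rw [← Complex.ofReal_add, ← Complex.ofReal_pow, ← Complex.ofReal_exp] at h'
  norm_cast at h'
  linarith [integral_real_exp_nonneg (-b)]

lemma summable_pow_natAbs {r : ℝ} (h0 : 0 ≤ r) (h1 : r < 1) :
    Summable fun n : ℤ => r ^ n.natAbs := by
  refine Summable.of_nat_of_neg ?_ ?_ <;>
  simpa using summable_geometric_of_lt_one h0 h1

lemma natAbs_le_sq (n : ℤ) : (n.natAbs : ℝ) ≤ (n : ℝ) ^ 2 := by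
  rw [Nat.cast_natAbs]
  norm_cast
  rw [← Int.natCast_natAbs, ← Int.natAbs_sq]
  exact_mod_cast Nat.le_self_pow two_ne_zero _

lemma exp_neg_mul_sq_le {c : ℝ} (hc : 0 ≤ c) (n : ℤ) :
    Real.exp (-(c * (n : ℝ) ^ 2)) ≤ Real.exp (-c) ^ n.natAbs := by
  rw [← Real.exp_nat_mul]
  gcongr
  nlinarith [natAbs_le_sq n]

lemma exp_neg_mul_add_half_sq_le {c : ℝ} (hc : 0 ≤ c) (n : ℤ) :
    Real.exp (-(c * ((n : ℝ) + 1 / 2) ^ 2)) ≤ Real.exp c * Real.exp (-c) ^ n.natAbs := by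
  rw [← Real.exp_nat_mul, ← Real.exp_add]
  gcongr
  have h1 : (n.natAbs : ℝ) = |(n : ℝ)| := by rw [Nat.cast_natAbs]; push_cast; rfl
  have h2 : |(n : ℝ)| ≤ ((n : ℝ) + 1 / 2) ^ 2 + 1 := by
    rw [abs_le]
    constructor <;> nlinarith [sq_nonneg ((n : ℝ) + 1)]
  rw [h1]
  nlinarith

/-- The half-integer shifted theta transformation. -/
lemma tsum_half_int_gaussian {a : ℝ} (ha : 0 < a) (s : ℝ) :
    ∑' n : ℤ, Complex.exp (-(((n : ℝ) + 1 / 2) * Real.pi / a : ℝ) ^ 2 +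
        Complex.I * (((n : ℝ) + 1 / 2) * Real.pi / a : ℝ) * s) =
      a / (Real.sqrt Real.pi : ℂ) *
        ∑' n : ℤ, (-1 : ℂ) ^ n * Complex.exp (-((s : ℂ) - 2 * a * n) ^ 2 / 4) := by
  have hpi : (Real.pi : ℂ) ≠ 0 := by exact_mod_cast Real.pi_pos.ne'
  have ha' : (a : ℂ) ≠ 0 := by exact_mod_cast ha.ne'
  -- Expanding `(n + 1/2)²` leaves a linear coefficient `2πb` and a constant part, collected in `C`
  -- below.
  set b : ℂ := (-(Real.pi / a) ^ 2 + Complex.I * (Real.pi / a) * s) / (2 * Real.pi) with hb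
  have key := Complex.tsum_exp_neg_quadratic (a := ((Real.pi / a ^ 2 : ℝ) : ℂ))
    (by rw [Complex.ofReal_re]; positivity) b
  have hroot : ((Real.pi / a ^ 2 : ℝ) : ℂ) ^ (1 / 2 : ℂ) = (Real.sqrt Real.pi : ℂ) / a := by
    rw [show (1 / 2 : ℂ) = ((1 / 2 : ℝ) : ℂ) by push_cast; ring,
      ← Complex.ofReal_cpow (by positivity), ← Real.sqrt_eq_rpow, Real.sqrt_div Real.pi_pos.le,
      Real.sqrt_sq ha.le]
    push_cast; rfl
  set C : ℂ := Complex.exp (-(Real.pi / a) ^ 2 / 4 + Complex.I * (Real.pi / a) * s / 2) with hC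
  have hL : ∀ n : ℤ, Complex.exp (-(((n : ℝ) + 1 / 2) * Real.pi / a : ℝ) ^ 2 +
        Complex.I * (((n : ℝ) + 1 / 2) * Real.pi / a : ℝ) * s) =
      C * Complex.exp (-Real.pi * ((Real.pi / a ^ 2 : ℝ) : ℂ) * n ^ 2 + 2 * Real.pi * b * n) := by
    intro n
    rw [hC, ← Complex.exp_add, hb]
    congr 1
    push_cast
    field_simp
    ring
  have hR : ∀ n : ℤ, C * Complex.exp (-Real.pi / ((Real.pi / a ^ 2 : ℝ) : ℂ) *
        (n + Complex.I * b) ^ 2) =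
      (-1 : ℂ) ^ n * Complex.exp (-((s : ℂ) - 2 * a * n) ^ 2 / 4) := by
    intro n
    rw [← Complex.exp_pi_mul_I, ← Complex.exp_int_mul, hC, ← Complex.exp_add, ← Complex.exp_add]
    congr 1
    have h1 : Complex.I * b = (-s - Complex.I * (Real.pi / a)) / (2 * a) := by
      rw [hb]
      field_simp
      linear_combination (s * a : ℂ) * Complex.I_sq
    have h2 : -(Real.pi : ℂ) / ((Real.pi / a ^ 2 : ℝ) : ℂ) = -a ^ 2 := by
      push_cast
      field_simp
    have h3 : -(a : ℂ) ^ 2 * (n + Complex.I * b) ^ 2 =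
        -(a * n - s / 2 - Complex.I * (Real.pi / a) / 2) ^ 2 := by
      rw [h1]
      field_simp
      ring
    have h4 : (Real.pi / a * a : ℂ) = Real.pi := div_mul_cancel₀ _ ha'
    rw [h2, h3]
    linear_combination (-((Real.pi : ℂ) / a) ^ 2 / 4) * Complex.I_sq + Complex.I * n * h4
  simp_rw [hL]
  rw [tsum_mul_left, key, ← mul_assoc, mul_comm C, mul_assoc, ← tsum_mul_left, hroot]
  simp_rw [hR]
  rw [one_div_div]

/-! ### Laplace transform of the theta transformation, term by term. -/

/-- The half-integer nodes of the modified trapezium rule with step `π / a`. -/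
def halfNode (a : ℝ) (n : ℤ) : ℝ :=
  ((n : ℝ) + 1 / 2) * Real.pi / a

lemma summable_exp_neg_halfNode_sq {a : ℝ} (ha : 0 < a) :
    Summable fun n : ℤ => Real.exp (-halfNode a n ^ 2) := by
  have hc : 0 < (Real.pi / a) ^ 2 := by have := Real.pi_pos; positivity
  refine Summable.of_nonneg_of_le (fun _ => (Real.exp_pos _).le) (fun n => ?_)
    ((summable_pow_natAbs (Real.exp_pos _).le
      (Real.exp_lt_one_iff.2 (neg_lt_zero.2 hc))).mul_left (Real.exp ((Real.pi / a) ^ 2)))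
  refine le_trans (le_of_eq ?_) (exp_neg_mul_add_half_sq_le hc.le n)
  congr 1
  rw [halfNode]
  ring

lemma integrableOn_exp_mul_exp {p : ℂ} (hp : 0 < p.re) (t : ℝ) :
    IntegrableOn (fun s : ℝ => Complex.exp (-(p * s)) *
      Complex.exp (-(t : ℂ) ^ 2 + Complex.I * t * s)) (Ioi 0) := by
  have h := (integrableOn_exp_mul_complex_Ioi (a := Complex.I * t - p) (by simpa using hp) 0).mul_const
    (Complex.exp (-(t : ℂ) ^ 2))
  refine h.congr (Eventually.of_forall fun s => ?_)
  simp only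
  rw [← Complex.exp_add, ← Complex.exp_add]
  congr 1
  ring

lemma integral_exp_mul_exp {p : ℂ} (hp : 0 < p.re) (t : ℝ) :
    ∫ s in Ioi (0 : ℝ), Complex.exp (-(p * s)) *
      Complex.exp (-(t : ℂ) ^ 2 + Complex.I * t * s) =
      Complex.exp (-(t : ℂ) ^ 2) / (p - Complex.I * t) := by
  have hre : (Complex.I * t - p).re < 0 := by simpa using hp
  have h := integral_exp_mul_complex_Ioi hre 0
  calc _ = ∫ s in Ioi (0 : ℝ), Complex.exp (-(t : ℂ) ^ 2) *
        Complex.exp ((Complex.I * t - p) * s) := by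
        congr 1
        ext s
        rw [← Complex.exp_add, ← Complex.exp_add]
        congr 1
        ring
    _ = _ := by
        rw [integral_const_mul, h, ← neg_sub p, Complex.ofReal_zero, mul_zero, Complex.exp_zero,
          neg_div_neg_eq, mul_one_div]

lemma integral_norm_exp_mul_exp {p : ℂ} (hp : 0 < p.re) (t : ℝ) :
    ∫ s in Ioi (0 : ℝ), ‖Complex.exp (-(p * s)) *
      Complex.exp (-(t : ℂ) ^ 2 + Complex.I * t * s)‖ = Real.exp (-t ^ 2) / p.re := by
  have h := integral_exp_mul_Ioi (a := -p.re) (by linarith) 0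
  calc _ = ∫ s in Ioi (0 : ℝ), Real.exp (-t ^ 2) * Real.exp (-p.re * s) := by
        congr 1
        ext s
        have e1 : -(t : ℂ) ^ 2 + Complex.I * t * s =
          ((-t ^ 2 : ℝ) : ℂ) + ((t * s : ℝ) : ℂ) * Complex.I := by push_cast; ring
        rw [norm_mul, Complex.norm_exp, e1, Complex.norm_exp, mul_comm, Complex.add_re,
          Complex.ofReal_re, Complex.re_ofReal_mul, Complex.neg_re, Complex.re_mul_ofReal]
        simp
    _ = _ := by
        rw [integral_const_mul, h]
        simp
        field_simp

lemma hasSum_exp_div_sub_halfNode {a : ℝ} (ha : 0 < a) {p : ℂ} (hp : 0 < p.re) :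
    HasSum (fun n : ℤ => Complex.exp (-(halfNode a n : ℂ) ^ 2) / (p - Complex.I * halfNode a n))
      (∫ s in Ioi (0 : ℝ), Complex.exp (-(p * s)) *
        ∑' n : ℤ, Complex.exp (-(halfNode a n : ℂ) ^ 2 + Complex.I * halfNode a n * s)) := by
  have h := hasSum_integral_of_summable_integral_norm (μ := volume.restrict (Ioi (0 : ℝ)))
    (F := fun (n : ℤ) (s : ℝ) => Complex.exp (-(p * s)) *
      Complex.exp (-(halfNode a n : ℂ) ^ 2 + Complex.I * halfNode a n * s))
    (fun n => integrableOn_exp_mul_exp hp (halfNode a n)) (by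
      simp_rw [integral_norm_exp_mul_exp hp]
      exact (summable_exp_neg_halfNode_sq ha).div_const _)
  simp_rw [integral_exp_mul_exp hp, tsum_mul_left] at h
  exact h

lemma exp_mul_exp_shifted (p : ℂ) (a s : ℝ) (n : ℤ) :
    Complex.exp (-(p * s)) *
        ((-1 : ℂ) ^ n * Complex.exp (-((s : ℂ) - 2 * a * n) ^ 2 / 4)) =
      (-1 : ℂ) ^ n * Complex.exp (-(n * a) ^ 2) *
        Complex.exp (-((p - n * a) * s) - (s : ℂ) ^ 2 / 4) := by
  rw [mul_left_comm, mul_assoc ((-1 : ℂ) ^ n), ← Complex.exp_add, ← Complex.exp_add]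
  congr 2
  ring

lemma norm_neg_one_zpow (n : ℤ) : ‖(-1 : ℂ) ^ n‖ = 1 := by simp [norm_zpow]

lemma norm_exp_neg_int_mul_sq (a : ℝ) (n : ℤ) :
    ‖Complex.exp (-((n : ℂ) * a) ^ 2)‖ = Real.exp (-(n * a) ^ 2) := by
  rw [Complex.norm_exp]
  congr 1
  norm_cast

lemma hasSum_shifted_gaussLaplace {a : ℝ} (ha : 0 < a) {p : ℂ} (hp : 0 < p.re) :
    HasSum (fun n : ℤ => (-1 : ℂ) ^ n * Complex.exp (-(n * a) ^ 2) * gaussLaplace (p - n * a))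
      (∫ s in Ioi (0 : ℝ), Complex.exp (-(p * s)) *
        ∑' n : ℤ, (-1 : ℂ) ^ n * Complex.exp (-((s : ℂ) - 2 * a * n) ^ 2 / 4)) := by
  set X := p.re with hX
  have hnorm : ∀ n : ℤ, ∫ s in Ioi (0 : ℝ), ‖(-1 : ℂ) ^ n * Complex.exp (-(n * a) ^ 2) *
        Complex.exp (-((p - n * a) * s) - (s : ℂ) ^ 2 / 4)‖ =
      Real.exp (-(n * a) ^ 2) *
        ∫ s in Ioi (0 : ℝ), Real.exp (-((X - n * a) * s) - s ^ 2 / 4) := by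
    intro n
    rw [← integral_const_mul]
    congr 1
    ext s
    rw [norm_mul, norm_mul, norm_neg_one_zpow, one_mul, norm_exp_neg_int_mul_sq, norm_exp_sub_sq]
    simp [hX]
  have h := hasSum_integral_of_summable_integral_norm (μ := volume.restrict (Ioi (0 : ℝ)))
    (F := fun (n : ℤ) (s : ℝ) => (-1 : ℂ) ^ n * Complex.exp (-(n * a) ^ 2) *
        Complex.exp (-((p - n * a) * s) - (s : ℂ) ^ 2 / 4))
    (fun n => ((integrable_exp_sub_sq (p - n * a)).integrableOn).const_mul _) (by
      simp_rw [hnorm]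
      have s1 := (summable_pow_natAbs (r := Real.exp (-(2 * X * a))) (Real.exp_pos _).le
        (Real.exp_lt_one_iff.2 (by rw [neg_lt_zero]; positivity))).mul_left
          (2 * Real.sqrt Real.pi * Real.exp (X ^ 2))
      have s2 := (summable_pow_natAbs (r := Real.exp (-(a ^ 2))) (Real.exp_pos _).le
        (Real.exp_lt_one_iff.2 (by rw [neg_lt_zero]; positivity))).mul_left (1 / X)
      refine Summable.of_nonneg_of_le
        (fun n => mul_nonneg (Real.exp_pos _).le (integral_real_exp_nonneg _)) (fun n => ?_)
        (s1.add s2)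
      -- For `n ≥ 0` the bound `2√π e^{(X-na)²}` cancels `e^{-n²a²}` and leaves `e^{X²-2Xna}`. For
      -- `n < 0` the integral is at most `1/X` and `e^{-n²a²}` itself decays.
      rcases le_or_gt 0 n with hn | hn
      · refine le_trans ?_ (le_add_of_nonneg_right (by positivity))
        have hn' : (n.natAbs : ℝ) = n := by
          rw [Nat.cast_natAbs, abs_of_nonneg hn]
        calc _ ≤ Real.exp (-(n * a) ^ 2) *
              (2 * Real.sqrt Real.pi * Real.exp ((X - n * a) ^ 2)) := by
              gcongr; exact integral_real_exp_le_exp_sq _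
          _ = _ := by
              rw [← Real.exp_nat_mul, hn', mul_left_comm, mul_assoc (2 * Real.sqrt Real.pi),
                ← Real.exp_add, ← Real.exp_add]
              ring_nf
      · refine le_trans ?_ (le_add_of_nonneg_left (by positivity))
        have hn' : (n : ℝ) < 0 := by exact_mod_cast hn
        have hpos : X ≤ X - n * a := by nlinarith
        rw [mul_comm]
        gcongr
        · refine (integral_real_exp_le_inv (by linarith)).trans ?_
          gcongr
        · refine le_trans (le_of_eq ?_) (exp_neg_mul_sq_le (sq_nonneg a) n)
          ring_nf)
  simp_rw [integral_const_mul, ← exp_mul_exp_shifted, tsum_mul_left] at h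
  exact h

/-- The Laplace transform of the half-integer theta transformation. -/
lemma exists_hasSum_halfNode {a : ℝ} (ha : 0 < a) {p : ℂ} (hp : 0 < p.re) :
    ∃ T : ℂ,
      HasSum (fun n : ℤ => (-1 : ℂ) ^ n * Complex.exp (-(n * a) ^ 2) * gaussLaplace (p - n * a)) T ∧
      HasSum (fun n : ℤ => Complex.exp (-(halfNode a n : ℂ) ^ 2) / (p - Complex.I * halfNode a n))
        (a / (Real.sqrt Real.pi : ℂ) * T) := by
  refine ⟨_, hasSum_shifted_gaussLaplace ha hp, ?_⟩
  convert hasSum_exp_div_sub_halfNode ha hp using 1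
  rw [← integral_const_mul]
  congr 1
  ext s
  rw [mul_left_comm]
  congr 1
  exact (tsum_half_int_gaussian ha s).symm

/-! ### The exact discretisation error. -/

lemma A_pos (N : ℕ) : 0 < A N :=
  Real.sqrt_pos.2 (by have := Real.pi_pos; positivity)

lemma A_sq (N : ℕ) : A N ^ 2 = ((N : ℝ) + 1 / 2) * Real.pi :=
  Real.sq_sqrt (by have := Real.pi_pos; positivity)

lemma node_succ (N n : ℕ) : node N (n + 1) = halfNode (A N) n := by
  rw [node, halfNode, A]
  push_cast
  ring

/-- The difference of Gaussian Laplace transforms governing the `m`-th aliasing error. -/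
def aliasDiff (a : ℝ) (p : ℂ) (m : ℕ) : ℂ :=
  gaussLaplace (m * a + p) - gaussLaplace (m * a - p)

/-- The `n`-th term of the trapezium sum. -/
def nodeTerm (N : ℕ) (x : ℝ) (n : ℕ) : ℂ :=
  Complex.exp (-(node N (n + 1) : ℂ) ^ 2) /
    ((x : ℂ) ^ 2 + Complex.I * (node N (n + 1) : ℂ) ^ 2)

lemma norm_exp_lt_one {a : ℝ} (ha : 0 < a) {p : ℂ} (hp : 0 < p.re) :
    ‖Complex.exp (-(2 * a * p))‖ < 1 := by
  rw [Complex.norm_exp, Real.exp_lt_one_iff,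
    show (2 * a * p : ℂ) = ((2 * a : ℝ) : ℂ) * p by push_cast; ring, Complex.neg_re,
    Complex.re_ofReal_mul, neg_lt_zero]
  positivity

lemma one_add_ne_zero_of_norm_lt_one {q : ℂ} (hq : ‖q‖ < 1) : 1 + q ≠ 0 := by
  intro h
  rw [show q = -1 by linear_combination h] at hq
  norm_num at hq

/-- Reflection at `p - ma`: completing the square in `e^{-(ma)²} e^{(p-ma)²} = e^{p²} e^{-2amp}`
makes the extra term geometric in `m`. -/
lemma alias_term_eq (a : ℝ) (p : ℂ) (m : ℕ) :
    (-1 : ℂ) ^ m * Complex.exp (-(m * a) ^ 2) *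
        (gaussLaplace (p - m * a) + gaussLaplace (p + m * a)) =
      (-1 : ℂ) ^ m * Complex.exp (-(m * a) ^ 2) * aliasDiff a p m +
        2 * Real.sqrt Real.pi * Complex.exp (p ^ 2) * (-Complex.exp (-(2 * a * p))) ^ m := by
  have h := gaussLaplace_add_neg (p - m * a)
  rw [neg_sub] at h
  have e : Complex.exp (-(m * a) ^ 2) * Complex.exp ((p - m * a) ^ 2) =
      Complex.exp (p ^ 2) * Complex.exp (-(2 * a * p)) ^ m := by
    rw [← Complex.exp_nat_mul, ← Complex.exp_add, ← Complex.exp_add]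
    congr 1
    ring
  rw [aliasDiff, neg_pow (Complex.exp _), add_comm p]
  linear_combination (-1 : ℂ) ^ m * Complex.exp (-(m * a) ^ 2) * h +
    (-1 : ℂ) ^ m * 2 * Real.sqrt Real.pi * e

lemma hasSum_aliasDiff {a : ℝ} (ha : 0 < a) {p T : ℂ} (hp : 0 < p.re)
    (hT : HasSum (fun n : ℤ => (-1 : ℂ) ^ n * Complex.exp (-(n * a) ^ 2) *
      gaussLaplace (p - n * a)) T) :
    HasSum (fun n : ℕ => (-1 : ℂ) ^ (n + 1) * Complex.exp (-((n + 1 : ℕ) * a) ^ 2) *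
        aliasDiff a p (n + 1))
      (T - gaussLaplace p + 2 * Real.sqrt Real.pi * Complex.exp (p ^ 2) *
        (Complex.exp (-(2 * a * p)) / (1 + Complex.exp (-(2 * a * p))))) := by
  set q := Complex.exp (-(2 * a * p)) with hq
  have hq1 : ‖q‖ < 1 := norm_exp_lt_one ha hp
  have hq0 := one_add_ne_zero_of_norm_lt_one hq1
  -- Pairing `n` with `-n` counts index `0` twice, so removing the first pair `2 G(p)` leaves `T -
  -- G(p)`.
  have h1 := (hasSum_nat_add_iff' 1).2 hT.nat_add_neg
  have hgeo := ((hasSum_geometric_of_norm_lt_one (ξ := -q) (by rwa [norm_neg])).mul_left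
    (2 * Real.sqrt Real.pi * Complex.exp (p ^ 2) * -q))
  have h2 := h1.sub hgeo
  have hval : T - gaussLaplace p + 2 * Real.sqrt Real.pi * Complex.exp (p ^ 2) * (q / (1 + q)) =
      T + (-1 : ℂ) ^ (0 : ℤ) * Complex.exp (-((0 : ℤ) * a) ^ 2) * gaussLaplace (p - (0 : ℤ) * a) -
        (2 * gaussLaplace p) -
        2 * Real.sqrt Real.pi * Complex.exp (p ^ 2) * -q * (1 - -q)⁻¹ := by
    simp
    field_simp
    ring
  have hrange : ∑ i ∈ Finset.range 1, ((-1 : ℂ) ^ (i : ℤ) * Complex.exp (-(((i : ℕ) : ℤ) * a) ^ 2) *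
      gaussLaplace (p - ((i : ℕ) : ℤ) * a) + (-1 : ℂ) ^ (-(i : ℤ)) *
      Complex.exp (-((-((i : ℕ) : ℤ) : ℤ) * a) ^ 2) *
      gaussLaplace (p - (-((i : ℕ) : ℤ) : ℤ) * a)) = 2 * gaussLaplace p := by
    simp
    ring
  rw [hrange, ← hval] at h2
  refine h2.congr_fun fun n => ?_
  have h := alias_term_eq a p (n + 1)
  have e : ∀ k : ℕ, (-1 : ℂ) ^ (-(k : ℤ)) = (-1 : ℂ) ^ k := by
    intro k
    rw [zpow_neg, zpow_natCast, ← inv_pow, inv_neg_one]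
  simp only [e, Int.cast_neg, Int.cast_natCast, zpow_natCast, neg_mul, neg_sq, sub_neg_eq_add]
  rw [← hq, pow_succ (-q)] at h
  linear_combination -h

lemma pair_div {p t : ℂ} (e : ℂ) (h1 : p - Complex.I * t ≠ 0) (h2 : p + Complex.I * t ≠ 0) :
    e / (p - Complex.I * t) + e / (p + Complex.I * t) = 2 * p * (e / (p ^ 2 + t ^ 2)) := by
  have h3 : p ^ 2 + t ^ 2 = (p - Complex.I * t) * (p + Complex.I * t) := by
    linear_combination t ^ 2 * Complex.I_sq
  rw [h3]
  field_simp
  ring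

lemma hasSum_nodeTerm {N : ℕ} {x : ℝ} (hx : 0 < x) {S : ℂ}
    (hS : HasSum (fun n : ℤ => Complex.exp (-(halfNode (A N) n : ℂ) ^ 2) /
      (rotate x - Complex.I * halfNode (A N) n)) S) :
    HasSum (nodeTerm N x) (S / (2 * Complex.I * rotate x)) := by
  have hre : 0 < (rotate x).re := by rw [rotate_re]; positivity
  have hp0 : rotate x ≠ 0 := by intro h; rw [h] at hre; simp at hre
  -- The indices `n` and `-(n+1)` carry opposite half-integer nodes.
  have h := hS.nat_add_neg_add_one.div_const (2 * Complex.I * rotate x)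
  refine h.congr_fun fun n => ?_
  have e : halfNode (A N) (-((n : ℤ) + 1)) = -halfNode (A N) n := by
    rw [halfNode, halfNode]; push_cast; ring
  rw [nodeTerm, node_succ, e]
  set t := halfNode (A N) n
  have h1 : rotate x - Complex.I * t ≠ 0 := by
    intro h
    have := congrArg Complex.re h
    simp at this
    linarith
  have h2 : rotate x + Complex.I * t ≠ 0 := by
    intro h
    have := congrArg Complex.re h
    simp at this
    linarith
  have h3 : (x : ℂ) ^ 2 + Complex.I * (t : ℂ) ^ 2 = Complex.I * (rotate x ^ 2 + (t : ℂ) ^ 2) := by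
    rw [rotate_sq]
    linear_combination (x : ℂ) ^ 2 * Complex.I_sq
  rw [Complex.ofReal_neg, neg_sq, mul_neg, sub_neg_eq_add, pair_div _ h1 h2, h3]
  field_simp

/-- Since `x e^{iπ/4} = i · rotate x`, the tangent is `i tanh(a · rotate x)` and the left side is
`(1 - tanh)/2`. -/
lemma half_add_tan {a x : ℝ} (h : 1 + Complex.exp (-(2 * a * rotate x)) ≠ 0) :
    1 / 2 + Complex.I / 2 *
        Complex.tan ((a : ℂ) * (x : ℂ) * Complex.exp (Complex.I * Real.pi / 4)) =
      Complex.exp (-(2 * a * rotate x)) / (1 + Complex.exp (-(2 * a * rotate x))) := by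
  have hw : (a : ℂ) * (x : ℂ) * Complex.exp (Complex.I * Real.pi / 4) = a * rotate x * Complex.I := by
    rw [exp_I_pi_div_four, rotate]
    push_cast
    linear_combination (-(a * x / (Real.sqrt 2 : ℝ) : ℂ)) * (-Complex.I_sq)
  rw [hw, Complex.tan_mul_I, Complex.tanh_eq_sinh_div_cosh, Complex.sinh, Complex.cosh]
  set u := (a : ℂ) * rotate x
  have e1 : Complex.exp (-(2 * a * rotate x)) = Complex.exp (-u) * Complex.exp (-u) := by
    rw [← Complex.exp_add]; congr 1; ring
  have e2 : Complex.exp u * Complex.exp (-u) = 1 := by rw [← Complex.exp_add]; simp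
  rw [e1] at h ⊢
  set E := Complex.exp (-u)
  set D := Complex.exp u
  have h5 : D + E ≠ 0 := by
    intro h6
    apply h
    linear_combination E * h6 - e2
  have h6 : E * E / (1 + E * E) = E / (D + E) := by
    rw [div_eq_div_iff h h5]
    linear_combination E * e2
  rw [h6]
  field_simp
  linear_combination (D - E) * Complex.I_sq

/-- The exact discretisation error of the untruncated modified trapezium rule. -/
lemma exists_discretisation_error (N : ℕ) {x : ℝ} (hx : 0 < x) :
    ∃ D S : ℂ,
      HasSum (fun n : ℕ => (-1 : ℂ) ^ (n + 1) * Complex.exp (-((n + 1 : ℕ) * A N) ^ 2) *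
        aliasDiff (A N) (rotate x) (n + 1)) D ∧
      HasSum (nodeTerm N x) S ∧
      err N x = -(Complex.exp (Complex.I * (x : ℂ) ^ 2) / (2 * Real.sqrt Real.pi)) * D +
        (x : ℂ) / (A N : ℂ) * Complex.exp (Complex.I * ((x : ℂ) ^ 2 + Real.pi / 4)) *
          (S - ∑ n ∈ Finset.range N, nodeTerm N x n) := by
  have hre : 0 < (rotate x).re := by rw [rotate_re]; positivity
  have hp0 : rotate x ≠ 0 := by intro h; rw [h] at hre; simp at hre
  obtain ⟨T, hT, hS⟩ := exists_hasSum_halfNode (A_pos N) hre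
  refine ⟨_, _, hasSum_aliasDiff (A_pos N) hre hT, hasSum_nodeTerm hx hS, ?_⟩
  have hq0 := one_add_ne_zero_of_norm_lt_one (norm_exp_lt_one (A_pos N) hre)
  have hsum : ∑ n ∈ Finset.range N, nodeTerm N x n = ∑ k ∈ Finset.Icc 1 N,
      Complex.exp (-(node N k : ℂ) ^ 2) / ((x : ℂ) ^ 2 + Complex.I * (node N k : ℂ) ^ 2) := by
    have hI : Finset.Icc 1 N = Finset.Ico (0 + 1) (N + 1) := by
      ext k
      simp only [Finset.mem_Icc, Finset.mem_Ico]
      omega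
    rw [hI, Finset.range_eq_Ico]
    exact Finset.sum_Ico_add' (fun k => Complex.exp (-(node N k : ℂ) ^ 2) /
      ((x : ℂ) ^ 2 + Complex.I * (node N k : ℂ) ^ 2)) 0 N 1
  have hA0 : (A N : ℂ) ≠ 0 := by exact_mod_cast (A_pos N).ne'
  have hpi : (Real.sqrt Real.pi : ℂ) ≠ 0 := by
    rw [Complex.ofReal_ne_zero]; exact (Real.sqrt_pos.2 Real.pi_pos).ne'
  have hrot : (x : ℂ) * Complex.exp (Complex.I * Real.pi / 4) = Complex.I * rotate x := by
    rw [exp_I_pi_div_four, rotate]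
    push_cast
    linear_combination (x / (Real.sqrt 2 : ℝ) : ℂ) * Complex.I_sq
  have hexp : Complex.exp (Complex.I * ((x : ℂ) ^ 2 + Real.pi / 4)) =
      Complex.exp (Complex.I * (x : ℂ) ^ 2) * Complex.exp (Complex.I * Real.pi / 4) := by
    rw [← Complex.exp_add]; congr 1; ring
  -- This makes the geometric sum of Gaussians, weighted by `e^{ix²}`, cancel the tangent term
  -- exactly.
  have hee : Complex.exp (Complex.I * (x : ℂ) ^ 2) * Complex.exp (rotate x ^ 2) = 1 := by
    rw [← Complex.exp_add, rotate_sq]; simp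
  rw [err, approxF, half_add_tan hq0, F_eq_closedF, closedF, hsum]
  set Q := Complex.exp (-(2 * A N * rotate x)) / (1 + Complex.exp (-(2 * A N * rotate x)))
  set W := ∑ k ∈ Finset.Icc 1 N,
      Complex.exp (-(node N k : ℂ) ^ 2) / ((x : ℂ) ^ 2 + Complex.I * (node N k : ℂ) ^ 2)
  rw [hexp]
  have hxx : (x : ℂ) / (A N : ℂ) * (Complex.exp (Complex.I * (x : ℂ) ^ 2) *
      Complex.exp (Complex.I * Real.pi / 4)) *
      (A N / (Real.sqrt Real.pi : ℂ) * T / (2 * Complex.I * rotate x)) =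
      Complex.exp (Complex.I * (x : ℂ) ^ 2) * T / (2 * Real.sqrt Real.pi) := by
    rw [mul_comm (Complex.exp (Complex.I * (x : ℂ) ^ 2)), ← mul_assoc, div_mul_eq_mul_div, hrot]
    field_simp [Complex.I_ne_zero]
  rw [mul_sub _ _ W, hxx, rotate_sq, neg_neg]
  rw [rotate_sq] at hee
  field_simp
  linear_combination (2 * Real.sqrt Real.pi * Q * A N : ℂ) * hee

/-! ### Bounds for a single aliasing difference. -/

lemma re_add_one_sub_I_mul (b X : ℝ) : ((b : ℂ) + (1 - Complex.I) * X).re = b + X := by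
  simp

lemma norm_gaussLaplace_add_le {b X : ℝ} (h : 0 < b + X) :
    ‖gaussLaplace (b + (1 - Complex.I) * X)‖ ≤ 1 / (b + X) := by
  have := norm_gaussLaplace_le (q := (b : ℂ) + (1 - Complex.I) * X)
    (by rwa [re_add_one_sub_I_mul])
  rwa [re_add_one_sub_I_mul] at this

lemma aliasDiff_eq (a X : ℝ) (m : ℕ) :
    aliasDiff a ((1 - Complex.I) * X) m =
      gaussLaplace ((m * a : ℝ) + (1 - Complex.I) * X) -
        gaussLaplace ((m * a : ℝ) - (1 - Complex.I) * X) := by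
  rw [aliasDiff]
  push_cast
  rfl

lemma norm_aliasDiff_le_of_lt {a X : ℝ} {m : ℕ} (hX : 0 ≤ X) (h : X < m * a) :
    ‖aliasDiff a ((1 - Complex.I) * X) m‖ ≤ 2 * Real.sqrt 2 * X / ((m * a) ^ 2 - X ^ 2) := by
  rw [aliasDiff_eq]
  exact norm_gaussLaplace_add_sub_le hX h

lemma norm_aliasDiff_le {a X : ℝ} {m : ℕ} (hX : 0 ≤ X) (h : 0 < m * a) :
    ‖aliasDiff a ((1 - Complex.I) * X) m‖ ≤ 1 / (m * a + X) + Real.sqrt 2 / (m * a) := by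
  rw [aliasDiff_eq]
  refine (norm_sub_le _ _).trans (add_le_add (norm_gaussLaplace_add_le (by linarith)) ?_)
  exact norm_gaussLaplace_sub_le h hX

/-- For `b < X` the argument lies in the left half-plane; reflection moves it to the right one at
the price of a Gaussian. -/
lemma norm_gaussLaplace_sub_le_of_gt {b X : ℝ} (h : b < X) :
    ‖gaussLaplace (b - (1 - Complex.I) * X)‖ ≤
      2 * Real.sqrt Real.pi * Real.exp (b ^ 2 - 2 * b * X) + 1 / (X - b) := by
  have href := gaussLaplace_add_neg (b - (1 - Complex.I) * X)
  have hneg : ‖gaussLaplace (-((b : ℂ) - (1 - Complex.I) * X))‖ ≤ 1 / (X - b) := by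
    have := norm_gaussLaplace_add_le (b := -b) (X := X) (by linarith)
    rw [show -((b : ℂ) - (1 - Complex.I) * X) = ((-b : ℝ) : ℂ) + (1 - Complex.I) * X by
      push_cast; ring]
    refine this.trans (le_of_eq ?_)
    ring
  have hexp : ‖Complex.exp (((b : ℂ) - (1 - Complex.I) * X) ^ 2)‖ =
      Real.exp (b ^ 2 - 2 * b * X) := by
    rw [← neg_neg (((b : ℂ) - (1 - Complex.I) * X) ^ 2), Complex.exp_neg, norm_inv,
      norm_exp_neg_sq_sub, ← Real.exp_neg]
    congr 1
    ring
  rw [eq_sub_of_add_eq href]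
  refine (norm_sub_le _ _).trans (add_le_add (le_of_eq ?_) hneg)
  rw [norm_mul, hexp, norm_mul, Complex.norm_real, Real.norm_of_nonneg (Real.sqrt_nonneg _),
    Complex.norm_ofNat]

lemma norm_aliasDiff_le_of_gt {a X : ℝ} {m : ℕ} (h0 : 0 < m * a) (h : m * a < X) :
    ‖aliasDiff a ((1 - Complex.I) * X) m‖ ≤
      2 * Real.sqrt Real.pi * Real.exp ((m * a) ^ 2 - 2 * (m * a) * X) +
        (1 / (m * a + X) + 1 / (X - m * a)) := by
  rw [aliasDiff_eq]
  refine (norm_sub_le _ _).trans ((add_le_add (norm_gaussLaplace_add_le (by linarith))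
    (norm_gaussLaplace_sub_le_of_gt h)).trans (le_of_eq ?_))
  ring

/-! ### Summing the aliasing series in the three regimes. -/

/-- The geometric weight dominating `e^{-((n+1)a)²}`. -/
def aliasWeight (a : ℝ) (n : ℕ) : ℝ :=
  Real.exp (-a ^ 2) * Real.exp (-2 * a ^ 2) ^ n

lemma aliasWeight_pos (a : ℝ) (n : ℕ) : 0 < aliasWeight a n := by
  unfold aliasWeight; positivity

/-- From `(n+1)² = n² + 2n + 1`. The extra factor `e^{-(na)²}` is bounded by `1` for `X < 5a/4`; the
far regime uses its bound `1/2` for `n ≥ 1`. -/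
lemma exp_neg_succ_mul_sq (a : ℝ) (n : ℕ) :
    Real.exp (-((n + 1 : ℕ) * a) ^ 2) = Real.exp (-(n * a) ^ 2) * aliasWeight a n := by
  rw [aliasWeight, ← Real.exp_nat_mul, ← Real.exp_add, ← Real.exp_add]
  congr 1
  push_cast
  ring

lemma exp_neg_mul_sq_le_one (a : ℝ) (n : ℕ) : Real.exp (-(n * a) ^ 2) ≤ 1 := by
  rw [Real.exp_le_one_iff, neg_nonpos]
  positivity

lemma exp_neg_mul_sq_le_half {a : ℝ} (ha : 3 / 2 ≤ a ^ 2) {n : ℕ} (hn : 1 ≤ n) :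
    Real.exp (-(n * a) ^ 2) ≤ 1 / 2 := by
  have hn' : (1 : ℝ) ≤ n := by exact_mod_cast hn
  have h1 : 1 ≤ (n * a) ^ 2 := by rw [mul_pow]; nlinarith
  rw [Real.exp_neg, ← one_div]
  gcongr
  linarith [Real.add_one_le_exp ((n * a) ^ 2)]

lemma hasSum_aliasWeight {a : ℝ} (ha : 0 < a) :
    HasSum (aliasWeight a) (Real.exp (-a ^ 2) / (1 - Real.exp (-2 * a ^ 2))) := by
  rw [div_eq_mul_inv]
  refine (hasSum_geometric_of_lt_one (Real.exp_pos _).le ?_).mul_left _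
  rw [Real.exp_lt_one_iff]
  nlinarith [pow_pos ha 2]

lemma norm_alias_term (a : ℝ) (p : ℂ) (n : ℕ) :
    ‖(-1 : ℂ) ^ (n + 1) * Complex.exp (-((n + 1 : ℕ) * a) ^ 2) * aliasDiff a p (n + 1)‖ =
      Real.exp (-(n * a) ^ 2) * aliasWeight a n * ‖aliasDiff a p (n + 1)‖ := by
  have h := norm_exp_neg_int_mul_sq a ((n + 1 : ℕ) : ℤ)
  rw [Int.cast_natCast, Int.cast_natCast] at h
  rw [norm_mul, norm_mul, norm_pow, norm_neg, norm_one, one_pow, one_mul, h, exp_neg_succ_mul_sq]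

lemma norm_alias_term_le {a C : ℝ} {p : ℂ} {n : ℕ} (h : ‖aliasDiff a p (n + 1)‖ ≤ C) :
    ‖(-1 : ℂ) ^ (n + 1) * Complex.exp (-((n + 1 : ℕ) * a) ^ 2) * aliasDiff a p (n + 1)‖ ≤
      aliasWeight a n * C := by
  rw [norm_alias_term]
  have h1 := exp_neg_mul_sq_le_one a n
  have h2 := aliasWeight_pos a n
  gcongr
  exact mul_le_of_le_one_left h2.le h1

lemma norm_alias_sum_le {a C : ℝ} (ha : 0 < a) {p D : ℂ}
    (hD : HasSum (fun n : ℕ => (-1 : ℂ) ^ (n + 1) * Complex.exp (-((n + 1 : ℕ) * a) ^ 2) *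
        aliasDiff a p (n + 1)) D)
    (h : ∀ n : ℕ, ‖aliasDiff a p (n + 1)‖ ≤ C) :
    ‖D‖ ≤ Real.exp (-a ^ 2) / (1 - Real.exp (-2 * a ^ 2)) * C := by
  rw [← hD.tsum_eq]
  exact tsum_of_norm_bounded ((hasSum_aliasWeight ha).mul_right C) fun n =>
    norm_alias_term_le (h n)

lemma norm_aliasDiff_le_near {a X : ℝ} (ha : 0 < a) (hX : 0 ≤ X) (h : X < a) (n : ℕ) :
    ‖aliasDiff a ((1 - Complex.I) * X) (n + 1)‖ ≤ 2 * Real.sqrt 2 * X / (a ^ 2 - X ^ 2) := by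
  have hm : a ≤ (n + 1 : ℕ) * a := by push_cast; nlinarith [Nat.cast_nonneg (α := ℝ) n]
  refine (norm_aliasDiff_le_of_lt hX (h.trans_le hm)).trans ?_
  have : 0 < a ^ 2 - X ^ 2 := by nlinarith
  gcongr

lemma norm_aliasDiff_le_middle {a X : ℝ} (ha : 0 < a) (h1 : 3 / 4 * a < X) (h2 : X < 5 / 4 * a)
    (n : ℕ) :
    ‖aliasDiff a ((1 - Complex.I) * X) (n + 1)‖ ≤ 8 * Real.sqrt 2 * X / (a * (a + X)) := by
  have hX : 0 < X := by linarith
  have hs : 1 ≤ Real.sqrt 2 := by rw [Real.one_le_sqrt]; norm_num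
  -- Only the first difference can be nearly singular, and it takes the uniform bound; for `n ≥ 1`,
  -- `(n+1)a ≥ 2a` stays away from `X`.
  rcases Nat.eq_zero_or_pos n with rfl | hn
  · refine (norm_aliasDiff_le hX.le (by simpa using ha)).trans ?_
    simp only [zero_add, Nat.cast_one, one_mul]
    rw [div_add_div _ _ (by positivity) (by positivity), div_le_div_iff₀ (by positivity)
      (by positivity), mul_comm (a + X) a]
    gcongr
    nlinarith
  · have hm : 2 * a ≤ (n + 1 : ℕ) * a := by
      have : (1 : ℝ) ≤ n := by exact_mod_cast hn
      push_cast; nlinarith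
    refine (norm_aliasDiff_le_of_lt hX.le (by linarith)).trans ?_
    have h3 : (2 * a) ^ 2 ≤ ((n + 1 : ℕ) * a) ^ 2 := by gcongr
    have h4 : a * (a + X) / 4 ≤ ((n + 1 : ℕ) * a) ^ 2 - X ^ 2 := by nlinarith
    calc _ ≤ 2 * Real.sqrt 2 * X / (a * (a + X) / 4) := by gcongr
      _ = _ := by field_simp; norm_num

lemma norm_alias_term_le_far {a X : ℝ} (ha : 0 < a) (ha2 : 3 / 2 ≤ a ^ 2) (h1 : 5 / 4 * a ≤ X)
    (n : ℕ) :
    ‖(-1 : ℂ) ^ (n + 1) * Complex.exp (-((n + 1 : ℕ) * a) ^ 2) *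
        aliasDiff a ((1 - Complex.I) * X) (n + 1)‖ ≤
      aliasWeight a n * (2 * Real.sqrt 2 * X / (X ^ 2 - a ^ 2)) +
        2 * Real.sqrt Real.pi * Real.exp (-(2 * a * X)) * Real.exp (-(2 * a * X)) ^ n := by
  have hX : 0 < X := by linarith
  have hs : 1 ≤ Real.sqrt 2 := by rw [Real.one_le_sqrt]; norm_num
  have hd : 0 < X ^ 2 - a ^ 2 := by nlinarith
  have hw := aliasWeight_pos a n
  have hC : 2 * Real.sqrt 2 / X ≤ 2 * Real.sqrt 2 * X / (X ^ 2 - a ^ 2) := by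
    rw [div_le_div_iff₀ hX hd]
    nlinarith [mul_pos (mul_pos (zero_lt_two) (lt_of_lt_of_le one_pos hs)) (pow_pos ha 2)]
  set m : ℝ := ((n + 1 : ℕ) : ℝ) with hm
  have hm1 : 1 ≤ m := by rw [hm]; push_cast; linarith [Nat.cast_nonneg (α := ℝ) n]
  have hma : 0 < m * a := by positivity
  -- The reflected bound contains `1/(X - ma)`, so it is used only when `X - ma` is controlled: `n =
  -- 0`, where `X ≥ 5a/4`, or `2ma ≤ X`. Otherwise `ma > X/2` and the uniform bound is already of
  -- order `1/X`.
  by_cases hcase : m * a < X ∧ (n = 0 ∨ 2 * (m * a) ≤ X)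
  · obtain ⟨hlt, hc⟩ := hcase
    have hb := norm_aliasDiff_le_of_gt hma hlt
    have hmain : Real.exp (-(n * a) ^ 2) * (1 / (m * a + X) + 1 / (X - m * a)) ≤
        2 * Real.sqrt 2 * X / (X ^ 2 - a ^ 2) := by
      rcases Nat.eq_zero_or_pos n with rfl | hn
      · have : m = 1 := by simp [hm]
        rw [this, one_mul]
        have h3 : X - a ≠ 0 := by linarith
        have h4 : a + X ≠ 0 := by linarith
        have h5 : 1 / (a + X) + 1 / (X - a) = 2 * X / (X ^ 2 - a ^ 2) := by
          have h6 : X ^ 2 - a ^ 2 = (a + X) * (X - a) := by ring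
          rw [h6]
          field_simp
          ring
        rw [h5]
        simp only [Nat.cast_zero, zero_mul, ne_eq, OfNat.ofNat_ne_zero, not_false_eq_true,
          zero_pow, neg_zero, Real.exp_zero, one_mul]
        gcongr
        linarith
      · have h2 : 2 * (m * a) ≤ X := hc.resolve_left hn.ne'
        refine le_trans ?_ hC
        have h3 := exp_neg_mul_sq_le_half ha2 hn
        calc _ ≤ 1 / 2 * (1 / X + 1 / (X / 2)) := by
              gcongr <;> linarith
          _ = (3 / 2) / X := by field_simp; norm_num
          _ ≤ _ := by gcongr; linarith
    -- The weight cancels `e^{(ma)²}`, leaving `e^{-2aXm}`, whose sum gives the last term of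
    -- `Delta`.
    have hres : Real.exp (-(n * a) ^ 2) * aliasWeight a n *
        (2 * Real.sqrt Real.pi * Real.exp ((m * a) ^ 2 - 2 * (m * a) * X)) =
        2 * Real.sqrt Real.pi * Real.exp (-(2 * a * X)) * Real.exp (-(2 * a * X)) ^ n := by
      rw [← exp_neg_succ_mul_sq, mul_left_comm, ← Real.exp_add,
        mul_assoc _ (Real.exp (-(2 * a * X))), ← pow_succ', ← Real.exp_nat_mul]
      congr 2
      rw [hm]
      ring
    rw [norm_alias_term]
    calc _ ≤ Real.exp (-(n * a) ^ 2) * aliasWeight a n *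
          (2 * Real.sqrt Real.pi * Real.exp ((m * a) ^ 2 - 2 * (m * a) * X) +
            (1 / (m * a + X) + 1 / (X - m * a))) := by gcongr
      _ = aliasWeight a n *
          (Real.exp (-(n * a) ^ 2) * (1 / (m * a + X) + 1 / (X - m * a))) +
          2 * Real.sqrt Real.pi * Real.exp (-(2 * a * X)) * Real.exp (-(2 * a * X)) ^ n := by
          rw [← hres]; ring
      _ ≤ _ := by gcongr
  · have hn : 1 ≤ n ∧ X < 2 * (m * a) := by
      rcases Nat.eq_zero_or_pos n with rfl | hn
      · exfalso
        apply hcase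
        have : m = 1 := by simp [hm]
        exact ⟨by rw [this]; linarith, Or.inl rfl⟩
      · refine ⟨hn, ?_⟩
        by_contra! hge
        exact hcase ⟨by linarith, Or.inr hge⟩
    have h3 := exp_neg_mul_sq_le_half ha2 hn.1
    have hb := norm_aliasDiff_le hX.le hma
    have hmain : Real.exp (-(n * a) ^ 2) * (1 / (m * a + X) + Real.sqrt 2 / (m * a)) ≤
        2 * Real.sqrt 2 * X / (X ^ 2 - a ^ 2) := by
      refine le_trans ?_ hC
      calc _ ≤ 1 / 2 * (1 / X + Real.sqrt 2 / (X / 2)) := by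
            gcongr <;> linarith [hn.2]
        _ = (1 / 2 + Real.sqrt 2) / X := by field_simp
        _ ≤ _ := by gcongr; linarith
    rw [norm_alias_term]
    refine le_trans ?_ (le_add_of_nonneg_right (by positivity))
    calc _ ≤ Real.exp (-(n * a) ^ 2) * aliasWeight a n *
          (1 / (m * a + X) + Real.sqrt 2 / (m * a)) := by gcongr
      _ = aliasWeight a n *
          (Real.exp (-(n * a) ^ 2) * (1 / (m * a + X) + Real.sqrt 2 / (m * a))) := by ring
      _ ≤ _ := by gcongr

lemma norm_alias_sum_le_far {a X : ℝ} (ha : 0 < a) (ha2 : 3 / 2 ≤ a ^ 2) (h1 : 5 / 4 * a ≤ X)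
    {D : ℂ}
    (hD : HasSum (fun n : ℕ => (-1 : ℂ) ^ (n + 1) * Complex.exp (-((n + 1 : ℕ) * a) ^ 2) *
        aliasDiff a ((1 - Complex.I) * X) (n + 1)) D) :
    ‖D‖ ≤ Real.exp (-a ^ 2) / (1 - Real.exp (-2 * a ^ 2)) *
        (2 * Real.sqrt 2 * X / (X ^ 2 - a ^ 2)) +
      2 * Real.sqrt Real.pi * Real.exp (-(2 * a * X)) * (1 - Real.exp (-(2 * a * X)))⁻¹ := by
  have hX : 0 < X := by linarith
  rw [← hD.tsum_eq]
  refine tsum_of_norm_bounded (((hasSum_aliasWeight ha).mul_right _).add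
    ((hasSum_geometric_of_lt_one (Real.exp_pos _).le ?_).mul_left _)) fun n =>
    norm_alias_term_le_far ha ha2 h1 n
  rw [Real.exp_lt_one_iff, neg_lt_zero]
  positivity

lemma three_halves_le_A_sq (N : ℕ) : 3 / 2 ≤ A N ^ 2 := by
  rw [A_sq]
  nlinarith [Real.pi_gt_three, Nat.cast_nonneg (α := ℝ) N]

lemma norm_alias_sum_div_le_Delta {N : ℕ} {x : ℝ} (hx : 0 < x) {D : ℂ}
    (hD : HasSum (fun n : ℕ => (-1 : ℂ) ^ (n + 1) * Complex.exp (-((n + 1 : ℕ) * A N) ^ 2) *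
        aliasDiff (A N) (rotate x) (n + 1)) D) :
    ‖D‖ / (2 * Real.sqrt Real.pi) ≤ Delta N x := by
  have ha := A_pos N
  have ha2 := three_halves_le_A_sq N
  rw [Delta]
  set a := A N
  set X := x / Real.sqrt 2 with hXdef
  have hs : 0 < Real.sqrt 2 := by positivity
  have hss : Real.sqrt 2 ^ 2 = 2 := Real.sq_sqrt (by norm_num)
  have hX : 0 < X := by positivity
  have hxX : x = Real.sqrt 2 * X := by rw [hXdef]; field_simp
  have hx2 : x ^ 2 / 2 = X ^ 2 := by rw [hxX, mul_pow, hss]; ring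
  have hpi : 0 < Real.sqrt Real.pi := Real.sqrt_pos.2 Real.pi_pos
  have hr : 0 < 1 - Real.exp (-2 * a ^ 2) := by
    rw [sub_pos, Real.exp_lt_one_iff]; linarith
  have hrot : rotate x = (1 - Complex.I) * X := rfl
  rw [hrot] at hD
  split_ifs with h1 h2
  · have hXa : X < a := by linarith
    have h := norm_alias_sum_le ha hD (norm_aliasDiff_le_near ha hX.le hXa)
    have hd : 0 < a ^ 2 - X ^ 2 := by nlinarith
    rw [hx2, div_le_iff₀ (by positivity)]
    refine h.trans (le_of_eq ?_)
    rw [hxX]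
    generalize Real.exp (-2 * a ^ 2) = r at hr ⊢
    field_simp
  · have h := norm_alias_sum_le ha hD (norm_aliasDiff_le_middle ha (not_le.1 h1) h2)
    rw [div_le_iff₀ (by positivity)]
    refine h.trans ?_
    -- The bound obtained is sharper than required: the factor involving `beta` is at least `1`
    -- whatever the value of `beta`.
    calc _ = 4 * x * Real.exp (-a ^ 2) * 1 /
          (Real.sqrt Real.pi * a * (a + X) * (1 - Real.exp (-2 * a ^ 2))) *
          (2 * Real.sqrt Real.pi) := by rw [hxX]; field_simp; norm_num
      _ ≤ _ := by
        gcongr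
        exact le_add_of_nonneg_right (by positivity)
  · have hge : 5 / 4 * a ≤ X := not_lt.1 h2
    have h := norm_alias_sum_le_far ha ha2 hge hD
    have hd : 0 < X ^ 2 - a ^ 2 := by nlinarith
    have he : -Real.sqrt 2 * a * x = -(2 * a * X) := by
      rw [hxX]; linear_combination -a * X * hss
    have hq : 0 < 1 - Real.exp (-(2 * a * X)) := by
      rw [sub_pos, Real.exp_lt_one_iff, neg_lt_zero]; positivity
    rw [hx2, he, div_le_iff₀ (by positivity)]
    refine h.trans (le_of_eq ?_)
    rw [hxX]
    generalize Real.exp (-2 * a ^ 2) = r at hr ⊢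
    generalize Real.exp (-(2 * a * X)) = q at hq ⊢
    field_simp

/-! ### The tail of the node sum. -/

lemma norm_sq_add_I_mul_sq (x t : ℝ) :
    ‖(x : ℂ) ^ 2 + Complex.I * (t : ℂ) ^ 2‖ = Real.sqrt (x ^ 4 + t ^ 4) := by
  rw [← Complex.ofReal_pow, ← Complex.ofReal_pow, mul_comm, Complex.norm_add_mul_I]
  congr 1
  ring

/-- The first omitted node equals `A N`, and later ones increase by steps of `π / A N`. -/
lemma sq_A_add_le_node_sq (N n : ℕ) : A N ^ 2 + 2 * Real.pi * n ≤ node N (n + N + 1) ^ 2 := by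
  have ha := A_pos N
  have h : node N (n + N + 1) = A N + n * Real.pi / A N := by
    rw [node_succ, halfNode]
    have := A_sq N
    push_cast
    field_simp
    linarith
  rw [h, add_sq]
  have : 2 * A N * (n * Real.pi / A N) = 2 * Real.pi * n := by field_simp
  rw [this]
  nlinarith [sq_nonneg (n * Real.pi / A N)]

lemma norm_nodeTerm_le (N : ℕ) (x : ℝ) (n : ℕ) :
    ‖nodeTerm N x (n + N)‖ ≤
      Real.exp (-(A N) ^ 2) / Real.sqrt (x ^ 4 + A N ^ 4) * Real.exp (-(2 * Real.pi)) ^ n := by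
  have ha := A_pos N
  have h := sq_A_add_le_node_sq N n
  set t := node N (n + N + 1)
  have hat : A N ^ 4 ≤ t ^ 4 := by
    have h2 : A N ^ 2 ≤ t ^ 2 := by
      have : 0 ≤ 2 * Real.pi * n := by have := Real.pi_pos; positivity
      linarith
    calc A N ^ 4 = (A N ^ 2) ^ 2 := by ring
      _ ≤ (t ^ 2) ^ 2 := by gcongr
      _ = t ^ 4 := by ring
  have hexp : ‖Complex.exp (-(t : ℂ) ^ 2)‖ = Real.exp (-t ^ 2) := by
    rw [← Complex.ofReal_pow, ← Complex.ofReal_neg, Complex.norm_exp, Complex.ofReal_re]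
  rw [nodeTerm, norm_div, norm_sq_add_I_mul_sq, hexp, div_mul_eq_mul_div]
  have hx4 : 0 ≤ x ^ 4 := by positivity
  gcongr
  rw [← Real.exp_nat_mul, ← Real.exp_add]
  gcongr
  linarith

lemma norm_node_tail_le {N : ℕ} {x : ℝ} {S : ℂ} (hS : HasSum (nodeTerm N x) S) :
    ‖S - ∑ n ∈ Finset.range N, nodeTerm N x n‖ ≤
      Real.exp (-(A N) ^ 2) / Real.sqrt (x ^ 4 + A N ^ 4) *
        ((2 * Real.pi + 1) / (2 * Real.pi)) := by
  have hpi := Real.pi_pos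
  have h := (hasSum_nat_add_iff' N).2 hS
  have hlt : Real.exp (-(2 * Real.pi)) < 1 := by rw [Real.exp_lt_one_iff]; linarith
  rw [← h.tsum_eq]
  refine (tsum_of_norm_bounded ((hasSum_geometric_of_lt_one (Real.exp_pos _).le hlt).mul_left _)
    (norm_nodeTerm_le N x)).trans ?_
  gcongr
  -- The constant comes from `e^{2π} ≥ 1 + 2π`, which gives `1/(1 - e^{-2π}) ≤ (2π+1)/(2π)`.
  rw [← one_div, div_le_div_iff₀ (by linarith) (by positivity)]
  have h1 := Real.add_one_le_exp (2 * Real.pi)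
  have h2 : Real.exp (2 * Real.pi) * Real.exp (-(2 * Real.pi)) = 1 := by
    rw [← Real.exp_add]; simp
  nlinarith [Real.exp_pos (-(2 * Real.pi))]

/-! ### Assembly of the two bounds. -/

lemma norm_err_le_eta_of_pos (N : ℕ) {x : ℝ} (hx : 0 < x) : ‖err N x‖ ≤ eta N x := by
  obtain ⟨D, S, hD, hS, h⟩ := exists_discretisation_error N hx
  have ha := A_pos N
  have hpi : 0 < Real.sqrt Real.pi := Real.sqrt_pos.2 Real.pi_pos
  have hexp : ‖Complex.exp (Complex.I * ((x : ℂ) ^ 2 + Real.pi / 4))‖ = 1 := by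
    rw [show Complex.I * ((x : ℂ) ^ 2 + Real.pi / 4) = ((x ^ 2 + Real.pi / 4 : ℝ) : ℂ) * Complex.I by
      push_cast; ring, Complex.norm_exp_ofReal_mul_I]
  rw [h, eta, abs_of_pos hx]
  refine (norm_add_le _ _).trans (add_le_add ?_ ?_)
  · rw [norm_mul, norm_neg, norm_div, norm_exp_I_mul_sq, norm_mul, Complex.norm_real,
      Real.norm_of_nonneg hpi.le, Complex.norm_ofNat, one_div_mul_eq_div]
    exact norm_alias_sum_div_le_Delta hx hD
  · rw [norm_mul, norm_mul, hexp, mul_one, norm_div, Complex.norm_real, Complex.norm_real,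
      Real.norm_of_nonneg hx.le, Real.norm_of_nonneg ha.le]
    calc _ ≤ x / A N * (Real.exp (-(A N) ^ 2) / Real.sqrt (x ^ 4 + A N ^ 4) *
        ((2 * Real.pi + 1) / (2 * Real.pi))) := by
          gcongr
          exact norm_node_tail_le hS
      _ = _ := by field_simp

lemma eta_neg (N : ℕ) (x : ℝ) : eta N (-x) = eta N x := by
  rw [eta, eta, abs_neg, Even.neg_pow (by decide)]

lemma eta_zero (N : ℕ) : eta N 0 = 0 := by
  simp [eta, Delta, (A_pos N).le]

end Fresnel

end

theorem theorem2 (N : ℕ) (x : ℝ) :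
    Filter.Tendsto (Fresnel.truncF x) Filter.atTop (nhds (Fresnel.F x)) ∧
      ‖Fresnel.err N x‖ ≤ Fresnel.eta N x := by
  -- `limUnder` takes an arbitrary value when no limit exists; the first component certifies that
  -- `F` is the genuine improper integral.
  refine ⟨by rw [Fresnel.F_eq_closedF]; exact Fresnel.tendsto_truncF x, ?_⟩
  rcases lt_trichotomy x 0 with hx | rfl | hx
  · have h := Fresnel.norm_err_le_eta_of_pos N (neg_pos.2 hx)
    rwa [Fresnel.err_neg, norm_neg, Fresnel.eta_neg] at h
  · rw [Fresnel.err_zero, Fresnel.eta_zero, norm_zero]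
  · exact Fresnel.norm_err_le_eta_of_pos N hx
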